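/- For $0<\alpha<\infty$ and $0<p<\infty$ let the Fock space $F^p_\alpha$ consist of all entire functions $f$ with $$\|f\|_{p,\alpha}^p=\frac{\alpha}{\pi}\int_{\mathbb C}\left|f(z)e^{-\frac{\alpha}{2}|z|^2}\right|^p dA(z)<\infty,$$ where $dA$ is Lebesgue area measure, and let $F^\infty_\alpha$ consist of all entire functions $f$ with $\sup_{z\in\mathbb C}|f(z)|e^{-\frac{\alpha}{2}|z|^2}<\infty$. A (finite or infinite) sequence $Z$ of complex numbers is called a zero sequence for $F^p_\alpha$ if there is a function $f\in F^p_\alpha$, not identically zero, which vanishes exactly on $Z$, counting multiplicities. For $\gamma>0$ let $\Lambda_\gamma=\{\sqrt{\pi/\gamma}\,(m+in):(m,n)\in\mathbb Z^2\}$, each point being counted once. Suppose $0<\alpha<\beta<\infty$, $0<p\le\infty$ and $0<q\le\infty$. Then every zero sequence for $F^p_\alpha$ is a zero sequence for $F^q_\beta$, but there exists a zero sequence for $F^q_\beta$ that is not a zero sequence for $F^p_\alpha$. In fact, for every $\gamma$ with $\alpha<\gamma<\beta$, the lattice $\Lambda_\gamma$ is a zero sequence for $F^q_\beta$ but not a zero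 sequence for $F^p_\alpha$. -/

import Mathlib

open scoped ENNReal

noncomputable section

/-- The (quasi-)norm of the Fock space with parameter `α` and exponent `p`, with values in `[0, ∞]`:
`((α / π) ∫ |f(z) exp(-α|z|²/2)| ^ p dA(z)) ^ (1/p)` for `p < ∞`, and
`sup_z |f(z)| exp(-α|z|²/2)` for `p = ∞`. Here `dA` is Lebesgue area measure on `ℂ`. -/
def fockNorm (α : ℝ) (p : ℝ≥0∞) (f : ℂ → ℂ) : ℝ≥0∞ :=
  if p = ∞ then
    ⨆ z : ℂ, ENNReal.ofReal (‖f z‖ * Real.exp (-(α / 2) * ‖z‖ ^ 2))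
  else
    (ENNReal.ofReal (α / Real.pi) *
      ∫⁻ z : ℂ, ENNReal.ofReal (‖f z‖ * Real.exp (-(α / 2) * ‖z‖ ^ 2)) ^ p.toReal) ^ (1 / p.toReal)

/-- The Fock space: all entire functions with finite Fock norm. -/
def fockSpace (α : ℝ) (p : ℝ≥0∞) : Set (ℂ → ℂ) :=
  {f | Differentiable ℂ f ∧ fockNorm α p f < ∞}

/-- A sequence `Z` of complex numbers, written as an indexed family in which repetitions encode
multiplicities (`ι` may be finite, even empty), is a zero sequence for a space `X` of entire
functions if some `f ∈ X`, not identically zero, vanishes exactly on `Z` counting multiplicities: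
for every `w`, the order of vanishing of `f` at `w` is the number of indices `i` with `Z i = w`. -/
def IsZeroSequence {ι : Type*} (X : Set (ℂ → ℂ)) (Z : ι → ℂ) : Prop :=
  ∃ f ∈ X, f ≠ 0 ∧ ∀ w : ℂ, analyticOrderAt f w = {i : ι | Z i = w}.encard

/-- The square lattice of points `√(π/γ) (m + i n)`, `(m, n) ∈ ℤ²`, each listed once. -/
def squareLattice (γ : ℝ) (mn : ℤ × ℤ) : ℂ :=
  (Real.sqrt (Real.pi / γ) : ℂ) * ((mn.1 : ℂ) + Complex.I * (mn.2 : ℂ))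

end

/-! Subharmonicity of `|f|^p` turns the integral condition into a pointwise one: a function in
`F^p_α` is `O(exp(α'|z|²/2))` for every `α' > α`. Conversely, such growth with `α' < β` gives
membership in `F^q_β`, since a decaying Gaussian remains. So `F^p_α ⊆ F^q_β`, and zero sequences
carry over (`fockSpace_subset_fockSpace`).

For the lattice, a theta product `L` has simple zeros exactly on `ℤ + iℤ`, and `|L(z)|
exp(-π|z|²/2)` is doubly periodic. By compactness `L` is bounded above by a multiple of
`exp(π|z|²/2)`, and below by another off discs about the zeros. Rescaled to `Λ_γ`, it has Gaussian
growth rate `γ/2`, so it lies in `F^q_β`. If `f ∈ F^p_α` had zero sequence `Λ_γ`, the rescaled `f`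
divided by `L` would be entire and, by the lower bound and the maximum principle, tend to `0` at
infinity; Liouville then forces `f = 0`. -/

/-! ### Sub-mean value property of `|f|^p` -/

section MeanValue

open MeasureTheory Real Metric

/-- Jensen's formula: each zero `u` in the closed disc contributes a term `log (R / |c - u|)` of
nonnegative sign. -/
theorem log_norm_le_circleAverage_log_norm {f : ℂ → ℂ} {c : ℂ} {R : ℝ} (hR : R ≠ 0)
    (hf : AnalyticOnNhd ℂ f (closedBall c |R|)) (hc : f c ≠ 0) :
    log ‖f c‖ ≤ circleAverage (fun z ↦ log ‖f z‖) c R := by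
  rw [hf.circleAverage_log_norm hR hc]
  have : 0 ≤ ∑ᶠ u, MeromorphicOn.divisor f (closedBall c |R|) u * log (R * ‖c - u‖⁻¹) := by
    refine finsum_nonneg fun u ↦ ?_
    by_cases hu : u ∈ closedBall c |R|
    · refine mul_nonneg ?_ ?_
      · exact_mod_cast MeromorphicOn.AnalyticOnNhd.divisor_nonneg hf u
      · rcases eq_or_ne c u with rfl | hcu
        · simp
        have hpos : 0 < ‖c - u‖ := norm_pos_iff.mpr (sub_ne_zero.mpr hcu)
        rw [← log_abs, abs_mul, abs_inv, abs_norm]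
        refine log_nonneg ?_
        rw [← div_eq_mul_inv, one_le_div hpos, ← dist_eq_norm, dist_comm]
        exact hu
    · simp [hu]
  linarith

/-- Exponentiating the logarithmic inequality gives this for all `p > 0`. With `|g c|^p = e`, the
tangent inequality `log t ≤ t / e` at `t = |g|^p` is an equality at the centre, so averaging it
loses nothing there. -/
theorem norm_rpow_le_circleAverage {f : ℂ → ℂ} (hf : Differentiable ℂ f) {p : ℝ} (hp : 0 < p)
    (c : ℂ) {R : ℝ} (hR : R ≠ 0) :
    ‖f c‖ ^ p ≤ circleAverage (fun z ↦ ‖f z‖ ^ p) c R := by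
  rcases eq_or_ne (f c) 0 with hc | hc
  · rw [hc, norm_zero, zero_rpow hp.ne']
    exact circleAverage_nonneg_of_nonneg fun z _ ↦ by positivity
  have hc' : 0 < ‖f c‖ := norm_pos_iff.mpr hc
  have hcont : Continuous fun z ↦ ‖f z‖ ^ p :=
    hf.continuous.norm.rpow_const fun _ ↦ Or.inr hp.le
  -- `f` is normalized to `g = K f` with `‖g c‖ ^ p = e`
  set K : ℝ := exp (1 / p) / ‖f c‖ with hK
  have hK0 : 0 < K := by positivity
  have hKp : K ^ p * ‖f c‖ ^ p = exp 1 := by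
    rw [← mul_rpow hK0.le hc'.le, hK, div_mul_cancel₀ _ hc'.ne', ← exp_mul,
      one_div_mul_cancel hp.ne']
  set g : ℂ → ℂ := fun z ↦ (K : ℂ) * f z with hg
  have hgn : ∀ z, ‖g z‖ = K * ‖f z‖ := fun z ↦ by simp [hg, abs_of_pos hK0]
  have hga : AnalyticOnNhd ℂ g (closedBall c |R|) := fun z _ ↦
    ((hf.const_mul (K : ℂ)).analyticAt z)
  have hlog := log_norm_le_circleAverage_log_norm hR hga (by simp [hg, hc, hK0.ne'])
  have hint : CircleIntegrable (fun z ↦ log ‖g z‖) c R :=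
    (hga.mono sphere_subset_closedBall).meromorphicOn.circleIntegrable_log_norm
  have hint2 : CircleIntegrable (fun z ↦ ‖f z‖ ^ p) c R := hcont.continuousOn.circleIntegrable'
  have key : circleAverage (fun z ↦ p * log ‖g z‖) c R ≤
      circleAverage (fun z ↦ K ^ p / exp 1 * ‖f z‖ ^ p) c R := by
    refine circleAverage_mono (by simpa [smul_eq_mul] using! hint.const_smul (a := p))
      (by simpa [smul_eq_mul] using! hint2.const_smul (a := K ^ p / exp 1)) fun z _ ↦ ?_
    rcases eq_or_ne (f z) 0 with hz | hz
    · simp [hgn, hz, zero_rpow hp.ne']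
    · have hz' : 0 < ‖f z‖ := norm_pos_iff.mpr hz
      have h1 := add_one_le_exp (log (K ^ p / exp 1 * ‖f z‖ ^ p))
      rw [exp_log (by positivity)] at h1
      rw [log_mul (by positivity) (by positivity), log_div (by positivity) (by positivity),
        log_exp, log_rpow hK0, log_rpow hz'] at h1
      rw [hgn, log_mul hK0.ne' hz'.ne']
      linarith
  have e1 : circleAverage (fun z ↦ p * log ‖g z‖) c R
      = p * circleAverage (fun z ↦ log ‖g z‖) c R := by
    simpa [smul_eq_mul] using! circleAverage_fun_smul (a := p) (f := fun z ↦ log ‖g z‖) (c := c) (R := R)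
  have e2 : circleAverage (fun z ↦ K ^ p / exp 1 * ‖f z‖ ^ p) c R
      = K ^ p / exp 1 * circleAverage (fun z ↦ ‖f z‖ ^ p) c R := by
    simpa [smul_eq_mul] using!
      circleAverage_fun_smul (a := K ^ p / exp 1) (f := fun z ↦ ‖f z‖ ^ p) (c := c) (R := R)
  rw [e1, e2] at key
  have h3 : p * log ‖g c‖ = 1 := by
    rw [hgn, hK, div_mul_cancel₀ _ hc'.ne', log_exp, mul_one_div_cancel hp.ne']
  have h4 : 1 ≤ K ^ p / exp 1 * circleAverage (fun z ↦ ‖f z‖ ^ p) c R := by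
    have := mul_le_mul_of_nonneg_left hlog hp.le
    linarith
  have h5 : K ^ p / exp 1 * ‖f c‖ ^ p = 1 := by
    rw [div_mul_eq_mul_div, hKp, div_self (exp_pos 1).ne']
  exact le_of_mul_le_mul_left (h5.le.trans h4) (by positivity)

/-- Circle averages are integrated in polar coordinates over `1/2 < r < 1` only. There the Jacobian
is at least `1/2`, which leaves the constant `π/2 ≥ 1`. -/
theorem ofReal_norm_rpow_le_lintegral_ball {f : ℂ → ℂ} (hf : Differentiable ℂ f) {p : ℝ}
    (hp : 0 < p) (c : ℂ) :
    ENNReal.ofReal (‖f c‖ ^ p) ≤ ∫⁻ z in ball c 1, ENNReal.ofReal (‖f z‖ ^ p) := by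
  have hcont : Continuous fun z ↦ ‖f z‖ ^ p :=
    hf.continuous.norm.rpow_const fun _ ↦ Or.inr hp.le
  set G : ℂ → ℝ≥0∞ := fun z ↦ ENNReal.ofReal (‖f z‖ ^ p) with hG
  have hGm : Measurable G := hcont.measurable.ennreal_ofReal
  set F : ℂ → ℝ≥0∞ := (ball c 1).indicator G with hF
  have hFm : Measurable F := hGm.indicator measurableSet_ball
  have hpolar : ∀ r θ : ℝ, c + Complex.polarCoord.symm (r, θ) = circleMap c r θ := fun r θ ↦ by
    simp [Complex.polarCoord_symm_apply, circleMap, Complex.exp_mul_I]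
  have inner : ∀ r ∈ Set.Ioo (1 / 2 : ℝ) 1, ENNReal.ofReal (2 * π * ‖f c‖ ^ p) ≤
      ∫⁻ θ in Set.Ioo (-π) π, F (circleMap c r θ) := by
    intro r hr
    have hr0 : 0 < r := by linarith [hr.1]
    have h1 : ∀ θ, F (circleMap c r θ) = ENNReal.ofReal (‖f (circleMap c r θ)‖ ^ p) := fun θ ↦ by
      rw [hF, Set.indicator_of_mem]
      rw [mem_ball, dist_eq_norm, circleMap_sub_center, norm_circleMap_zero, abs_of_pos hr0]
      exact hr.2
    have h2 : Continuous fun θ ↦ ‖f (circleMap c r θ)‖ ^ p := hcont.comp (continuous_circleMap c r)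
    simp_rw [h1]
    rw [Measure.restrict_congr_set Ioo_ae_eq_Ioc, ← ofReal_integral_eq_lintegral_ofReal
      ((h2.integrableOn_Icc (a := -π) (b := π)).mono_set Set.Ioc_subset_Icc_self)
      (Filter.Eventually.of_forall fun θ ↦ by positivity),
      ← intervalIntegral.integral_of_le (by linarith [pi_pos])]
    refine ENNReal.ofReal_le_ofReal ?_
    have h3 := norm_rpow_le_circleAverage hf hp c hr0.ne'
    have hper : (fun θ ↦ ‖f (circleMap c r θ)‖ ^ p).Periodic (2 * π) := fun x ↦ by
      simp [periodic_circleMap c r x]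
    have h4 := hper.intervalIntegral_add_eq (-π) 0
    rw [show -π + 2 * π = π by ring, zero_add] at h4
    rw [h4]
    rw [circleAverage_def, smul_eq_mul, inv_mul_eq_div, le_div_iff₀ (by positivity)] at h3
    linarith
  calc ENNReal.ofReal (‖f c‖ ^ p)
      ≤ ENNReal.ofReal (1 / 2 * (2 * π * ‖f c‖ ^ p)) * ENNReal.ofReal (1 / 2) := by
        rw [← ENNReal.ofReal_mul (by positivity)]
        refine ENNReal.ofReal_le_ofReal ?_
        have : 0 ≤ ‖f c‖ ^ p := by positivity
        nlinarith [pi_gt_three]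
    _ = ∫⁻ _ in Set.Ioo (1 / 2 : ℝ) 1, ENNReal.ofReal (1 / 2 * (2 * π * ‖f c‖ ^ p)) := by
        rw [setLIntegral_const, Real.volume_Ioo]
        norm_num
    _ ≤ ∫⁻ r in Set.Ioo (1 / 2 : ℝ) 1, ∫⁻ θ in Set.Ioo (-π) π,
          ENNReal.ofReal r * F (circleMap c r θ) := by
        refine setLIntegral_mono' measurableSet_Ioo fun r hr ↦ ?_
        rw [lintegral_const_mul' _ _ ENNReal.ofReal_ne_top, ENNReal.ofReal_mul (by norm_num)]
        exact mul_le_mul' (ENNReal.ofReal_le_ofReal hr.1.le) (inner r hr)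
    _ = ∫⁻ x in Set.Ioo (1 / 2 : ℝ) 1 ×ˢ Set.Ioo (-π) π,
          ENNReal.ofReal x.1 * F (circleMap c x.1 x.2) := by
        rw [Measure.volume_eq_prod, setLIntegral_prod]
        have : Continuous fun x : ℝ × ℝ ↦ circleMap c x.1 x.2 := by fun_prop [circleMap]
        exact ((measurable_fst.ennreal_ofReal).mul (hFm.comp this.measurable)).aemeasurable
    _ ≤ ∫⁻ x in polarCoord.target, ENNReal.ofReal x.1 * F (circleMap c x.1 x.2) := by
        refine lintegral_mono_set (Set.prod_mono (fun r hr ↦ ?_) subset_rfl)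
        exact lt_trans (by norm_num) hr.1
    _ = ∫⁻ z, F (c + z) := by
        rw [← Complex.lintegral_comp_polarCoord_symm]
        refine lintegral_congr fun x ↦ ?_
        rw [← hpolar, smul_eq_mul]
    _ = ∫⁻ z, F z := lintegral_add_left_eq_self F c
    _ = ∫⁻ z in ball c 1, G z := lintegral_indicator measurableSet_ball _

end MeanValue

/-! ### Pointwise growth and inclusion of Fock spaces -/

section Growth

open MeasureTheory Real Metric

theorem mul_sq_norm_le_of_mem_ball {a b : ℝ} (ha : 0 < a) (hab : a < b) :
    ∃ D : ℝ, ∀ z w : ℂ, w ∈ ball z 1 → a * ‖w‖ ^ 2 ≤ b * ‖z‖ ^ 2 + D := by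
  -- Expand `a (‖z‖ + 1)²` and absorb the cross term: `2a‖z‖ ≤ (b - a)‖z‖² + a²/(b - a)`.
  refine ⟨a + a ^ 2 / (b - a), fun z w hw ↦ ?_⟩
  have h1 : ‖w‖ ≤ ‖z‖ + 1 := by
    have h2 : ‖w - z‖ < 1 := by rwa [← dist_eq_norm]
    have := norm_le_norm_add_norm_sub z w
    rw [norm_sub_rev] at this
    linarith
  have h2 : ‖w‖ ^ 2 ≤ (‖z‖ + 1) ^ 2 := by gcongr
  have h3 : 0 < b - a := sub_pos.mpr hab
  have h4 : 0 ≤ ((b - a) * ‖z‖ - a) ^ 2 / (b - a) := by positivity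
  have h5 : ((b - a) * ‖z‖ - a) ^ 2 / (b - a) = (b - a) * ‖z‖ ^ 2 - 2 * a * ‖z‖ + a ^ 2 / (b - a) := by
    field_simp
    ring
  nlinarith

theorem lintegral_lt_top_of_fockNorm_lt_top {α : ℝ} (hα : 0 < α) {p : ℝ≥0∞} (hp : 0 < p)
    (hp' : p ≠ ∞) {f : ℂ → ℂ} (hf : fockNorm α p f < ∞) :
    ∫⁻ z : ℂ, ENNReal.ofReal (‖f z‖ * exp (-(α / 2) * ‖z‖ ^ 2)) ^ p.toReal < ∞ := by
  have hp0 : 0 < p.toReal := ENNReal.toReal_pos hp.ne' hp'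
  rw [fockNorm, if_neg hp', ENNReal.rpow_lt_top_iff_of_pos (by positivity)] at hf
  have hc : ENNReal.ofReal (α / π) ≠ 0 := by
    rw [Ne, ENNReal.ofReal_eq_zero, not_le]
    positivity
  by_contra h
  rw [not_lt_top_iff.mp h, ENNReal.mul_top hc] at hf
  exact lt_irrefl _ hf

/-- For finite `p`, `|f z|^p` is at most its integral over the unit disc about `z`; the variation of
the weight across that disc is absorbed by enlarging `α` to `α'`. -/
theorem exists_norm_le_of_mem_fockSpace {α α' : ℝ} (hα : 0 < α) (hα' : α < α') {p : ℝ≥0∞}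
    (hp : 0 < p) {f : ℂ → ℂ} (hf : f ∈ fockSpace α p) :
    ∃ C : ℝ, 0 < C ∧ ∀ z, ‖f z‖ ≤ C * exp (α' / 2 * ‖z‖ ^ 2) := by
  obtain ⟨hd, hn⟩ := hf
  by_cases hp' : p = ∞
  · rw [fockNorm, if_pos hp'] at hn
    set S : ℝ≥0∞ := ⨆ z : ℂ, ENNReal.ofReal (‖f z‖ * exp (-(α / 2) * ‖z‖ ^ 2)) with hS
    refine ⟨S.toReal + 1, by positivity, fun z ↦ ?_⟩
    have h1 : ‖f z‖ * exp (-(α / 2) * ‖z‖ ^ 2) ≤ S.toReal :=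
      (ENNReal.ofReal_le_iff_le_toReal hn.ne).mp (le_iSup (fun z : ℂ ↦
        ENNReal.ofReal (‖f z‖ * exp (-(α / 2) * ‖z‖ ^ 2))) z)
    have h2 : ‖f z‖ = ‖f z‖ * exp (-(α / 2) * ‖z‖ ^ 2) * exp (α / 2 * ‖z‖ ^ 2) := by
      rw [mul_assoc, ← exp_add, neg_mul, neg_add_cancel, exp_zero, mul_one]
    rw [h2]
    gcongr
    linarith
  · have hp0 : 0 < p.toReal := ENNReal.toReal_pos hp.ne' hp'
    have hI := lintegral_lt_top_of_fockNorm_lt_top hα hp hp' hn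
    set r := p.toReal with hr
    set I : ℝ≥0∞ := ∫⁻ z : ℂ, ENNReal.ofReal (‖f z‖ * exp (-(α / 2) * ‖z‖ ^ 2)) ^ r
    obtain ⟨D, hD⟩ := mul_sq_norm_le_of_mem_ball (a := r * (α / 2)) (b := r * (α' / 2))
      (by positivity) (by gcongr)
    have key : ∀ z, ‖f z‖ ^ r ≤ exp (r * (α' / 2) * ‖z‖ ^ 2 + D) * I.toReal := fun z ↦ by
      have h1 : ENNReal.ofReal (‖f z‖ ^ r) ≤
          ENNReal.ofReal (exp (r * (α' / 2) * ‖z‖ ^ 2 + D)) * I := by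
        calc _ ≤ ∫⁻ w in ball z 1, ENNReal.ofReal (‖f w‖ ^ r) :=
              ofReal_norm_rpow_le_lintegral_ball hd hp0 z
          _ ≤ ∫⁻ w in ball z 1, ENNReal.ofReal (exp (r * (α' / 2) * ‖z‖ ^ 2 + D)) *
                ENNReal.ofReal (‖f w‖ * exp (-(α / 2) * ‖w‖ ^ 2)) ^ r := by
              refine setLIntegral_mono' measurableSet_ball fun w hw ↦ ?_
              rw [ENNReal.ofReal_rpow_of_nonneg (by positivity) hp0.le,
                ← ENNReal.ofReal_mul (by positivity)]
              refine ENNReal.ofReal_le_ofReal ?_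
              rw [mul_rpow (by positivity) (by positivity), ← exp_mul, mul_left_comm, ← exp_add]
              refine le_mul_of_one_le_right (by positivity) (one_le_exp ?_)
              linarith [hD z w hw]
          _ = ENNReal.ofReal (exp (r * (α' / 2) * ‖z‖ ^ 2 + D)) *
                ∫⁻ w in ball z 1, ENNReal.ofReal (‖f w‖ * exp (-(α / 2) * ‖w‖ ^ 2)) ^ r :=
              lintegral_const_mul' _ _ ENNReal.ofReal_ne_top
          _ ≤ _ := by gcongr; exact setLIntegral_le_lintegral _ _
      have h2 := (ENNReal.ofReal_le_iff_le_toReal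
        (ENNReal.mul_ne_top ENNReal.ofReal_ne_top hI.ne)).mp h1
      rwa [ENNReal.toReal_mul, ENNReal.toReal_ofReal (exp_pos _).le] at h2
    refine ⟨(exp D * (I.toReal + 1)) ^ (1 / r), by positivity, fun z ↦ ?_⟩
    rw [← rpow_le_rpow_iff (norm_nonneg _) (by positivity) hp0,
      mul_rpow (by positivity) (by positivity), ← rpow_mul (by positivity),
      one_div_mul_cancel hp0.ne', rpow_one, ← exp_mul]
    refine (key z).trans ?_
    rw [exp_add, show α' / 2 * ‖z‖ ^ 2 * r = r * (α' / 2) * ‖z‖ ^ 2 by ring]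
    have : 0 < exp (r * (α' / 2) * ‖z‖ ^ 2) * exp D := by positivity
    nlinarith

theorem mem_fockSpace_of_norm_le {α β C : ℝ} (hαβ : α < β) {q : ℝ≥0∞} (hq : 0 < q) {f : ℂ → ℂ}
    (hd : Differentiable ℂ f) (hC : 0 < C) (hf : ∀ z, ‖f z‖ ≤ C * exp (α / 2 * ‖z‖ ^ 2)) :
    f ∈ fockSpace β q := by
  refine ⟨hd, ?_⟩
  have hle : ∀ z, ‖f z‖ * exp (-(β / 2) * ‖z‖ ^ 2) ≤ C * exp (-((β - α) / 2) * ‖z‖ ^ 2) :=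
    fun z ↦ by
      calc _ ≤ C * exp (α / 2 * ‖z‖ ^ 2) * exp (-(β / 2) * ‖z‖ ^ 2) := by gcongr; exact hf z
        _ = _ := by rw [mul_assoc, ← exp_add]; ring_nf
  have hb : 0 < (β - α) / 2 := by linarith
  rw [fockNorm]
  split_ifs with hq'
  · refine lt_of_le_of_lt (iSup_le fun z ↦ ENNReal.ofReal_le_ofReal ((hle z).trans (?_ : _ ≤ C)))
      ENNReal.ofReal_lt_top
    refine mul_le_of_le_one_right hC.le (exp_le_one_iff.mpr ?_)
    have : 0 ≤ ‖z‖ ^ 2 := by positivity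
    nlinarith
  · have hq0 : 0 < q.toReal := ENNReal.toReal_pos hq.ne' hq'
    set r := q.toReal
    refine ENNReal.rpow_lt_top_of_nonneg (by positivity)
      (ENNReal.mul_ne_top ENNReal.ofReal_ne_top (ne_of_lt ?_))
    have hint : Integrable fun z : ℂ ↦ C ^ r * exp (-(r * ((β - α) / 2)) * ‖z‖ ^ 2) := by
      -- The real Gaussian is the norm of the complex one with zero linear term.
      have h1 := (GaussianFourier.integrable_cexp_neg_mul_sq_norm_add (V := ℂ)
        (b := ((r * ((β - α) / 2) : ℝ) : ℂ)) (by rw [Complex.ofReal_re]; positivity) 0 0).norm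
      refine (h1.congr (Filter.Eventually.of_forall fun z ↦ ?_)).const_mul _
      simp only [zero_mul, add_zero, Complex.norm_exp]
      norm_cast
    refine lt_of_le_of_lt (lintegral_mono fun z ↦ ?_) hint.lintegral_lt_top
    rw [ENNReal.ofReal_rpow_of_nonneg (by positivity) hq0.le]
    refine ENNReal.ofReal_le_ofReal ((rpow_le_rpow (by positivity) (hle z) hq0.le).trans_eq ?_)
    rw [mul_rpow hC.le (exp_pos _).le, ← exp_mul]
    ring_nf

theorem fockSpace_subset_fockSpace {α β : ℝ} (hα : 0 < α) (hαβ : α < β) {p q : ℝ≥0∞}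
    (hp : 0 < p) (hq : 0 < q) : fockSpace α p ⊆ fockSpace β q := by
  intro f hf
  obtain ⟨α', h1, h2⟩ := exists_between hαβ
  obtain ⟨C, hC, hle⟩ := exists_norm_le_of_mem_fockSpace hα h1 hp hf
  exact mem_fockSpace_of_norm_le h2 hq hf.1 hC hle

end Growth

/-! ### Division of entire functions -/

section Quotient

open Filter Topology Set

/-- The meromorphic normal form of `f / g` has nonnegative order everywhere, hence is analytic. The
factorization holds off the zeros of `g` and extends to them by continuity. -/
theorem exists_differentiable_mul_of_analyticOrderAt_le {f g : ℂ → ℂ} (hf : Differentiable ℂ f)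
    (hg : Differentiable ℂ g) (hgt : ∀ z, analyticOrderAt g z ≠ ⊤)
    (hle : ∀ z, analyticOrderAt g z ≤ analyticOrderAt f z) :
    ∃ h : ℂ → ℂ, Differentiable ℂ h ∧ ∀ z, f z = g z * h z := by
  have hfa := fun z ↦ hf.analyticAt z
  have hga := fun z ↦ hg.analyticAt z
  have hm : MeromorphicOn (f / g) univ := fun z _ ↦ (hfa z).meromorphicAt.div (hga z).meromorphicAt
  have hane : ∀ z, AnalyticAt ℂ (toMeromorphicNFOn (f / g) univ) z := fun z ↦ by
    rw [← (meromorphicNFOn_toMeromorphicNFOn (f / g) univ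
      (mem_univ z)).meromorphicOrderAt_nonneg_iff_analyticAt,
      meromorphicOrderAt_toMeromorphicNFOn hm (mem_univ z),
      meromorphicOrderAt_div (hfa z).meromorphicAt (hga z).meromorphicAt,
      (hfa z).meromorphicOrderAt_eq, (hga z).meromorphicOrderAt_eq]
    obtain ⟨n, hn⟩ := ENat.ne_top_iff_exists.mp (hgt z)
    have h1 := hle z
    rw [← hn] at h1 ⊢
    cases hord : analyticOrderAt f z with
    | top => simp
    | coe m =>
      rw [hord] at h1
      have h2 : n ≤ m := by exact_mod_cast h1
      simp only [ENat.map_natCast]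
      norm_cast
      omega
  refine ⟨_, fun z ↦ (hane z).differentiableAt, fun z ↦ ?_⟩
  have hev : ∀ᶠ w in 𝓝[≠] z, g w ≠ 0 := by
    rcases (hga z).eventually_eq_zero_or_eventually_ne_zero with h | h
    · exact absurd (analyticOrderAt_eq_top.mpr h) (hgt z)
    · exact h
  have heq : f =ᶠ[𝓝[≠] z] fun w ↦ g w * toMeromorphicNFOn (f / g) univ w := by
    filter_upwards [hev, hm.toMeromorphicNFOn_eq_self_on_nhdsNE (mem_univ z)] with w h1 h2
    rw [h2, Pi.div_apply, mul_div_cancel₀ _ h1]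
  refine tendsto_nhds_unique ((hf.continuous.tendsto z).mono_left nhdsWithin_le_nhds)
    (Tendsto.congr' heq.symm ?_)
  exact (((hga z).continuousAt.mul (hane z).continuousAt).tendsto).mono_left nhdsWithin_le_nhds

end Quotient

/-! ### The `q`-product with `q = e^{-2π}` -/

section QProduct

open Filter Topology Set

/-- The entire function `∏_{n ≥ 1} (1 - e^{-2πn} u)`, a `q`-Pochhammer symbol. -/
noncomputable def qProduct (u : ℂ) : ℂ :=
  ∏' n : ℕ, (1 + -((Real.exp (-2 * Real.pi) : ℂ) ^ (n + 1) * u))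

theorem exp_neg_two_pi_lt_one : Real.exp (-2 * Real.pi) < 1 :=
  Real.exp_lt_one_iff.mpr (by linarith [Real.pi_pos])

theorem summable_exp_pow_succ_mul (R : ℝ) :
    Summable fun n : ℕ ↦ Real.exp (-2 * Real.pi) ^ (n + 1) * R :=
  ((summable_nat_add_iff 1).mpr (summable_geometric_of_lt_one (Real.exp_pos _).le
    exp_neg_two_pi_lt_one)).mul_right R

theorem norm_exp_pow_succ_mul (n : ℕ) (u : ℂ) :
    ‖-((Real.exp (-2 * Real.pi) : ℂ) ^ (n + 1) * u)‖ = Real.exp (-2 * Real.pi) ^ (n + 1) * ‖u‖ := by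
  rw [norm_neg, norm_mul, norm_pow, Complex.norm_real, Real.norm_eq_abs, Real.abs_exp]

theorem summable_norm_exp_pow_succ_mul (u : ℂ) :
    Summable fun n : ℕ ↦ ‖-((Real.exp (-2 * Real.pi) : ℂ) ^ (n + 1) * u)‖ := by
  simp_rw [norm_exp_pow_succ_mul]
  exact summable_exp_pow_succ_mul ‖u‖

theorem differentiable_qProduct : Differentiable ℂ qProduct := by
  intro z
  have h := Summable.hasProdLocallyUniformlyOn_nat_one_add
    (f := fun (n : ℕ) (u : ℂ) ↦ -((Real.exp (-2 * Real.pi) : ℂ) ^ (n + 1) * u))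
    (K := Metric.ball 0 (‖z‖ + 1)) Metric.isOpen_ball (summable_exp_pow_succ_mul (‖z‖ + 1))
    (Eventually.of_forall fun n x hx ↦ by
      rw [norm_exp_pow_succ_mul]
      rw [mem_ball_zero_iff] at hx
      gcongr) (fun n ↦ by fun_prop)
  have hd := h.differentiableOn (Eventually.of_forall fun s ↦ by
    simpa [Finset.prod_fn] using DifferentiableOn.finsetProd (fun _ _ ↦ by fun_prop))
    Metric.isOpen_ball
  exact hd.differentiableAt (Metric.isOpen_ball.mem_nhds (by simp))

theorem tprod_one_sub_pow_succ_mul {q u : ℂ}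
    (h : Multipliable fun n : ℕ ↦ 1 + -(q ^ (n + 1) * (q * u))) :
    ∏' n : ℕ, (1 + -(q ^ (n + 1) * u)) =
      (1 - q * u) * ∏' n : ℕ, (1 + -(q ^ (n + 1) * (q * u))) := by
  have he : (fun n : ℕ ↦ 1 + -(q ^ (n + 1) * (q * u))) =
      fun n ↦ (fun k : ℕ ↦ 1 + -(q ^ (k + 1) * u)) (n + 1) := by
    funext n
    ring
  rw [he] at h ⊢
  have h1 := tprod_eq_zero_mul' (f := fun k : ℕ ↦ 1 + -(q ^ (k + 1) * u)) h
  have h2 : 1 + -(q ^ (0 + 1) * u) = 1 - q * u := by ring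
  exact h1.trans (congrArg (· * _) h2)

/-- Splitting off the first factor shifts the product; this yields the quasi-period `I` of the
lattice function. -/
theorem qProduct_eq_mul (u : ℂ) :
    qProduct u = (1 - Real.exp (-2 * Real.pi) * u) * qProduct (Real.exp (-2 * Real.pi) * u) :=
  tprod_one_sub_pow_succ_mul
    (multipliable_one_add_of_summable (summable_norm_exp_pow_succ_mul _))

/-- An absolutely convergent product vanishes only if a factor does, and here every `e^{-2π(n+1)}
|u|` is below `1`. -/
theorem qProduct_ne_zero {u : ℂ} (hu : Real.exp (-2 * Real.pi) * ‖u‖ < 1) : qProduct u ≠ 0 := by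
  refine tprod_one_add_ne_zero_of_summable (fun n h ↦ ?_) (summable_norm_exp_pow_succ_mul u)
  have h1 : ‖-((Real.exp (-2 * Real.pi) : ℂ) ^ (n + 1) * u)‖ = 1 := by
    rw [eq_neg_of_add_eq_zero_right h, norm_neg, norm_one]
  rw [norm_exp_pow_succ_mul, pow_succ, mul_assoc] at h1
  have h2 := pow_le_one₀ (n := n) (Real.exp_pos (-2 * Real.pi)).le exp_neg_two_pi_lt_one.le
  have h3 : 0 ≤ Real.exp (-2 * Real.pi) * ‖u‖ := by positivity
  nlinarith

end QProduct

/-! ### A theta function with zeros on `ℤ + iℤ` -/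

section LatticeFunction

open Filter Topology Set Complex

/-- An entire function vanishing exactly on `ℤ + iℤ`, a multiple of a Jacobi theta function by
the exponential of a quadratic polynomial (and so a multiple of the Weierstrass sigma function),
written as an infinite product. -/
noncomputable def latticeFunction (z : ℂ) : ℂ :=
  (1 - exp (2 * Real.pi * I * z)) * (qProduct (exp (2 * Real.pi * I * z)) *
    qProduct (exp (-(2 * Real.pi * I * z)))) * exp (Real.pi / 2 * z ^ 2 - I * Real.pi * z)

theorem differentiable_latticeFunction : Differentiable ℂ latticeFunction := by
  have h := differentiable_qProduct
  unfold latticeFunction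
  fun_prop

theorem exp_two_pi_I_mul_add_I (z : ℂ) :
    exp (2 * Real.pi * I * (z + I)) = Real.exp (-2 * Real.pi) * exp (2 * Real.pi * I * z) := by
  rw [ofReal_exp, ← exp_add]
  congr 1
  push_cast
  linear_combination (2 * Real.pi : ℂ) * I_sq

theorem latticeFunction_add_one (z : ℂ) :
    latticeFunction (z + 1) = exp (Real.pi * z + (Real.pi / 2 - I * Real.pi)) * latticeFunction z := by
  have h1 : exp (2 * Real.pi * I * (z + 1)) = exp (2 * Real.pi * I * z) := by
    rw [mul_add, mul_one, exp_add, exp_two_pi_mul_I, mul_one]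
  have h2 : exp (Real.pi / 2 * (z + 1) ^ 2 - I * Real.pi * (z + 1)) =
      exp (Real.pi * z + (Real.pi / 2 - I * Real.pi)) * exp (Real.pi / 2 * z ^ 2 - I * Real.pi * z) := by
    rw [← exp_add]
    ring_nf
  rw [latticeFunction, exp_neg, h1, h2, latticeFunction, exp_neg]
  ring

/-- The shift replaces `w` by `Q w`. The two `q`-products exchange the factor `1 - Q w` for `1 -
w⁻¹`, and `(1 - w⁻¹) w = -(1 - w)` restores the prefactor with a sign. -/
theorem latticeFunction_add_I (z : ℂ) :
    latticeFunction (z + I) = -exp (-(Real.pi * I * z) + Real.pi / 2) * latticeFunction z := by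
  set w := exp (2 * Real.pi * I * z) with hw
  set Q : ℂ := ((Real.exp (-2 * Real.pi) : ℝ) : ℂ) with hQ
  have hQ0 : Q ≠ 0 := by rw [hQ]; exact_mod_cast (Real.exp_pos _).ne'
  have hw0 : w ≠ 0 := exp_ne_zero _
  have h1 : exp (-(2 * Real.pi * I * (z + I))) = (Q * w)⁻¹ := by
    rw [exp_neg, exp_two_pi_I_mul_add_I]
  have h2 : exp (-(2 * Real.pi * I * z)) = w⁻¹ := by rw [exp_neg]
  have h3 : exp (Real.pi / 2 * (z + I) ^ 2 - I * Real.pi * (z + I)) =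
      w * exp (-(Real.pi * I * z) + Real.pi / 2) * exp (Real.pi / 2 * z ^ 2 - I * Real.pi * z) := by
    rw [hw, ← exp_add, ← exp_add]
    congr 1
    linear_combination (-Real.pi / 2 : ℂ) * I_sq
  have h4 : qProduct w = (1 - Q * w) * qProduct (Q * w) := qProduct_eq_mul w
  have h5 : qProduct (Q * w)⁻¹ = (1 - w⁻¹) * qProduct w⁻¹ := by
    rw [qProduct_eq_mul (Q * w)⁻¹, ← hQ, mul_inv, mul_inv_cancel_left₀ hQ0]
  rw [latticeFunction, h1, h3, exp_two_pi_I_mul_add_I, ← hw, ← hQ, latticeFunction, h2, ← hw, h4, h5]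
  have h6 : (1 - w⁻¹) * w = -(1 - w) := by field_simp; ring
  linear_combination (1 - Q * w) * qProduct (Q * w) * qProduct w⁻¹ *
    exp (-(Real.pi * I * z) + Real.pi / 2) * exp (Real.pi / 2 * z ^ 2 - I * Real.pi * z) * h6

/-- The modulus of the lattice function, normalized to be doubly periodic. -/
noncomputable def latticeModulus (z : ℂ) : ℝ :=
  ‖latticeFunction z‖ * Real.exp (-(Real.pi / 2) * ‖z‖ ^ 2)

theorem continuous_latticeModulus : Continuous latticeModulus := by
  have := differentiable_latticeFunction.continuous
  unfold latticeModulus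
  fun_prop

theorem sq_norm_eq (z : ℂ) : ‖z‖ ^ 2 = z.re ^ 2 + z.im ^ 2 := by
  rw [← normSq_eq_norm_sq, normSq_apply]
  ring

/-- The multiplier has modulus `exp(π Re z + π/2)`, which the Gaussian cancels because `|z + 1|² -
|z|² = 2 Re z + 1`. The shift by `I` works alike with `Im z`. -/
theorem latticeModulus_add_one (z : ℂ) : latticeModulus (z + 1) = latticeModulus z := by
  rw [latticeModulus, latticeFunction_add_one, norm_mul, norm_exp, latticeModulus, mul_right_comm,
    ← Real.exp_add, sq_norm_eq, sq_norm_eq, mul_comm]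
  congr 2
  simp
  ring

theorem latticeModulus_add_I (z : ℂ) : latticeModulus (z + I) = latticeModulus z := by
  rw [latticeModulus, latticeFunction_add_I, norm_mul, norm_neg, norm_exp, latticeModulus,
    mul_right_comm, ← Real.exp_add, sq_norm_eq, sq_norm_eq, mul_comm]
  congr 2
  simp
  ring

theorem latticeModulus_add_int_add_int_mul_I (z : ℂ) (m n : ℤ) :
    latticeModulus (z + (m + n * I)) = latticeModulus z := by
  have h1 : Function.Periodic latticeModulus 1 := latticeModulus_add_one
  have h2 : Function.Periodic latticeModulus I := latticeModulus_add_I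
  rw [← add_assoc, (h2.int_mul n) (z + m)]
  simpa using (h1.int_mul m) z

theorem analyticOrderAt_latticeFunction_add_I (z : ℂ) :
    analyticOrderAt latticeFunction (z + I) = analyticOrderAt latticeFunction z := by
  have ha := fun z ↦ differentiable_latticeFunction.analyticAt z
  have h1 : AnalyticAt ℂ (fun z : ℂ ↦ -exp (-(Real.pi * I * z) + Real.pi / 2)) z := by fun_prop
  have h2 : latticeFunction ∘ (· + I) =
      (fun z : ℂ ↦ -exp (-(Real.pi * I * z) + Real.pi / 2)) * latticeFunction :=
    funext fun z ↦ latticeFunction_add_I z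
  rw [← analyticOrderAt_comp_of_deriv_ne_zero (g := (· + I)) (z₀ := z) (by fun_prop) (by simp), h2,
    analyticOrderAt_mul h1 (ha z), h1.analyticOrderAt_eq_zero.mpr (by simp), zero_add]

theorem analyticOrderAt_latticeFunction_add_int_mul_I (z : ℂ) (n : ℤ) :
    analyticOrderAt latticeFunction (z + n * I) = analyticOrderAt latticeFunction z :=
  Function.Periodic.int_mul (f := analyticOrderAt latticeFunction)
    analyticOrderAt_latticeFunction_add_I n z

theorem exp_two_pi_I_mul_eq_one_iff (z : ℂ) :
    exp (2 * Real.pi * I * z) = 1 ↔ ∃ m : ℤ, z = m := by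
  have : (2 * Real.pi * I : ℂ) ≠ 0 := by simp [Real.pi_ne_zero]
  rw [exp_eq_one_iff]
  refine exists_congr fun m ↦ ?_
  rw [mul_comm, mul_left_inj' this]

/-- The numbers to be kept below `1` are `e^{-2π(1 + Im z)}` and `e^{-2π(1 - Im z)}`. Hence in this
strip only the factor `1 - exp(2πiz)` can vanish. -/
theorem qProduct_mul_qProduct_ne_zero {z : ℂ} (h0 : 0 ≤ z.im) (h1 : z.im < 1) :
    qProduct (exp (2 * Real.pi * I * z)) * qProduct (exp (-(2 * Real.pi * I * z))) ≠ 0 := by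
  have hpi := Real.pi_pos
  refine mul_ne_zero (qProduct_ne_zero ?_) (qProduct_ne_zero ?_) <;>
  · rw [norm_exp, ← Real.exp_add, Real.exp_lt_one_iff]
    simp
    nlinarith

open scoped Classical in
theorem analyticOrderAt_latticeFunction_of_strip {z : ℂ} (h0 : 0 ≤ z.im) (h1 : z.im < 1) :
    analyticOrderAt latticeFunction z = if ∃ m : ℤ, z = m then 1 else 0 := by
  have hq := differentiable_qProduct
  have hA : AnalyticAt ℂ (fun z : ℂ ↦ 1 - exp (2 * Real.pi * I * z)) z := by fun_prop
  have hB : AnalyticAt ℂ (fun z : ℂ ↦ qProduct (exp (2 * Real.pi * I * z)) *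
      qProduct (exp (-(2 * Real.pi * I * z)))) z :=
    Differentiable.analyticAt (by fun_prop) z
  have hC : AnalyticAt ℂ (fun z : ℂ ↦ exp (Real.pi / 2 * z ^ 2 - I * Real.pi * z)) z := by fun_prop
  have hL : latticeFunction = (fun z : ℂ ↦ 1 - exp (2 * Real.pi * I * z)) *
      (fun z : ℂ ↦ qProduct (exp (2 * Real.pi * I * z)) *
      qProduct (exp (-(2 * Real.pi * I * z)))) *
      (fun z : ℂ ↦ exp (Real.pi / 2 * z ^ 2 - I * Real.pi * z)) := rfl
  rw [hL, analyticOrderAt_mul (hA.mul hB) hC, analyticOrderAt_mul hA hB,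
    hB.analyticOrderAt_eq_zero.mpr (qProduct_mul_qProduct_ne_zero h0 h1),
    hC.analyticOrderAt_eq_zero.mpr (exp_ne_zero _), add_zero, add_zero]
  split_ifs with h
  · have hz := (exp_two_pi_I_mul_eq_one_iff z).mpr h
    have hd : HasDerivAt (fun z : ℂ ↦ 1 - exp (2 * Real.pi * I * z))
        (-(exp (2 * Real.pi * I * z) * (2 * Real.pi * I * 1))) z :=
      (((hasDerivAt_id z).const_mul _).cexp).const_sub 1
    have := hA.analyticOrderAt_sub_eq_one_of_deriv_ne_zero
      (by rw [hd.deriv, hz]; simp [Real.pi_ne_zero])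
    simpa [hz] using this
  · rw [hA.analyticOrderAt_eq_zero, sub_ne_zero]
    exact fun h' ↦ h ((exp_two_pi_I_mul_eq_one_iff z).mp h'.symm)

open scoped Classical in
theorem analyticOrderAt_latticeFunction (z : ℂ) :
    analyticOrderAt latticeFunction z = if ∃ m n : ℤ, z = m + n * I then 1 else 0 := by
  have hz : z = (z - ⌊z.im⌋ * I) + ⌊z.im⌋ * I := by ring
  have him : (z - ⌊z.im⌋ * I).im = Int.fract z.im := by simp
  conv_lhs => rw [hz]
  rw [analyticOrderAt_latticeFunction_add_int_mul_I, analyticOrderAt_latticeFunction_of_strip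
    (him ▸ Int.fract_nonneg _) (him ▸ Int.fract_lt_one _)]
  refine if_congr ⟨fun ⟨m, hm⟩ ↦ ⟨m, ⌊z.im⌋, by rw [← hm]; ring⟩, fun ⟨m, n, h⟩ ↦ ⟨m, ?_⟩⟩ rfl rfl
  have : ⌊z.im⌋ = n := by rw [h]; simp
  rw [this, h]
  ring

theorem latticeFunction_eq_zero_iff (z : ℂ) :
    latticeFunction z = 0 ↔ ∃ m n : ℤ, z = m + n * I := by
  rw [← not_iff_not, ← Ne, ← (differentiable_latticeFunction.analyticAt z).analyticOrderAt_eq_zero,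
    analyticOrderAt_latticeFunction]
  split_ifs with h <;> simp [h]

theorem exists_add_int_add_int_mul_I (z : ℂ) :
    ∃ (w : ℂ) (m n : ℤ), |w.re| ≤ 1 / 2 ∧ |w.im| ≤ 1 / 2 ∧ z = w + (m + n * I) := by
  refine ⟨z - (round z.re + round z.im * I), round z.re, round z.im, ?_, ?_, by ring⟩
  · simpa using abs_sub_round z.re
  · simpa using abs_sub_round z.im

theorem isCompact_square : IsCompact {w : ℂ | |w.re| ≤ 1 / 2 ∧ |w.im| ≤ 1 / 2} := by
  refine Metric.isCompact_of_isClosed_isBounded ?_ ?_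
  · exact (isClosed_le continuous_re.abs continuous_const).inter
      (isClosed_le continuous_im.abs continuous_const)
  · refine isBounded_iff_forall_norm_le.mpr ⟨1, fun w hw ↦ ?_⟩
    linarith [norm_le_abs_re_add_abs_im w, hw.1, hw.2]

theorem exists_norm_latticeFunction_le :
    ∃ M : ℝ, 0 < M ∧ ∀ z, ‖latticeFunction z‖ ≤ M * Real.exp (Real.pi / 2 * ‖z‖ ^ 2) := by
  obtain ⟨M, hM⟩ := isCompact_square.exists_bound_of_continuousOn
    continuous_latticeModulus.continuousOn
  refine ⟨|M| + 1, by positivity, fun z ↦ ?_⟩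
  obtain ⟨w, m, n, hr, hi, rfl⟩ := exists_add_int_add_int_mul_I z
  have h1 : latticeModulus (w + (m + n * I)) ≤ |M| + 1 := by
    rw [latticeModulus_add_int_add_int_mul_I]
    linarith [Real.le_norm_self (latticeModulus w), hM w ⟨hr, hi⟩, le_abs_self M]
  rw [latticeModulus, neg_mul, Real.exp_neg, ← div_eq_mul_inv, div_le_iff₀ (Real.exp_pos _)] at h1
  exact h1

theorem exists_le_norm_latticeFunction :
    ∃ c : ℝ, 0 < c ∧ ∀ z : ℂ, (∀ m n : ℤ, 1 / 4 ≤ ‖z - (m + n * I)‖) →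
      c * Real.exp (Real.pi / 2 * ‖z‖ ^ 2) ≤ ‖latticeFunction z‖ := by
  -- A fundamental square without the disc of radius `1/4` about `0`, its only lattice point; the
  -- continuous modulus has a positive minimum on it.
  set K : Set ℂ := {w : ℂ | |w.re| ≤ 1 / 2 ∧ |w.im| ≤ 1 / 2} ∩ {w | 1 / 4 ≤ ‖w‖} with hK
  have hKc : IsCompact K := isCompact_square.inter_right (isClosed_le (by fun_prop) (by fun_prop))
  have hpos : ∀ w ∈ K, 0 < latticeModulus w := fun w hw ↦ by
    refine mul_pos (norm_pos_iff.mpr fun h ↦ ?_) (Real.exp_pos _)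
    obtain ⟨m, n, h⟩ := (latticeFunction_eq_zero_iff w).mp h
    have e : ∀ k : ℤ, |(k : ℝ)| ≤ 1 / 2 → k = 0 := fun k hk ↦ by
      have : |(k : ℝ)| < 1 := by linarith
      exact Int.abs_lt_one_iff.mp (by exact_mod_cast this)
    have hm := e m (by simpa [h] using hw.1.1)
    have hn := e n (by simpa [h] using hw.1.2)
    have := hw.2
    norm_num [h, hm, hn] at this
  obtain ⟨c, hc, hle⟩ : ∃ c : ℝ, 0 < c ∧ ∀ w ∈ K, c ≤ latticeModulus w := by
    rcases K.eq_empty_or_nonempty with hne | hne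
    · exact ⟨1, one_pos, by simp [hne]⟩
    · obtain ⟨w, hw, hmin⟩ := hKc.exists_isMinOn hne continuous_latticeModulus.continuousOn
      exact ⟨_, hpos w hw, hmin⟩
  refine ⟨c, hc, fun z hz ↦ ?_⟩
  obtain ⟨w, m, n, hr, hi, rfl⟩ := exists_add_int_add_int_mul_I z
  have h1 : c ≤ latticeModulus (w + (m + n * I)) := by
    rw [latticeModulus_add_int_add_int_mul_I]
    exact hle w ⟨⟨hr, hi⟩, by simpa using hz m n⟩
  rw [latticeModulus, neg_mul, Real.exp_neg, ← div_eq_mul_inv, le_div_iff₀ (Real.exp_pos _)] at h1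
  exact h1

end LatticeFunction

/-! ### The lattice as a zero sequence, and uniqueness below its density -/

section ZeroSequences

open Filter Topology Set

theorem squareLattice_injective {γ : ℝ} (hγ : 0 < γ) : Function.Injective (squareLattice γ) := by
  rintro ⟨a, b⟩ ⟨c, d⟩ h
  have hs : (Real.sqrt (Real.pi / γ) : ℂ) ≠ 0 := by
    have : 0 < Real.sqrt (Real.pi / γ) := Real.sqrt_pos.mpr (div_pos Real.pi_pos hγ)
    exact_mod_cast this.ne'
  have h1 := mul_left_cancel₀ hs h
  have hre := congrArg Complex.re h1
  have him := congrArg Complex.im h1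
  simp at hre him
  rw [hre, him]

theorem encard_squareLattice_fiber {γ : ℝ} (hγ : 0 < γ) (w : ℂ) :
    {i | squareLattice γ i = Real.sqrt (Real.pi / γ) * w}.encard =
      analyticOrderAt latticeFunction w := by
  have hs : (Real.sqrt (Real.pi / γ) : ℂ) ≠ 0 := by
    have : 0 < Real.sqrt (Real.pi / γ) := Real.sqrt_pos.mpr (div_pos Real.pi_pos hγ)
    exact_mod_cast this.ne'
  rw [analyticOrderAt_latticeFunction]
  split_ifs with h
  · obtain ⟨m, n, rfl⟩ := h
    rw [encard_eq_one]
    refine ⟨(m, n), eq_singleton_iff_unique_mem.mpr ⟨?_, fun i hi ↦ squareLattice_injective hγ ?_⟩⟩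
    · simp [squareLattice, mul_comm]
    · rw [mem_ofPred_eq.mp hi]
      simp [squareLattice, mul_comm]
  · rw [encard_eq_zero, eq_empty_iff_forall_notMem]
    rintro ⟨m, n⟩ hi
    exact h ⟨m, n, by rw [← mul_left_cancel₀ hs hi, mul_comm Complex.I]⟩

theorem analyticOrderAt_comp_const_mul (f : ℂ → ℂ) {a : ℂ} (ha : a ≠ 0) (z : ℂ) :
    analyticOrderAt (fun w ↦ f (a * w)) z = analyticOrderAt f (a * z) :=
  analyticOrderAt_comp_of_deriv_ne_zero (g := fun w ↦ a * w) (by fun_prop) (by simpa using ha)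

theorem isZeroSequence_fockSpace_squareLattice {β γ : ℝ} (hγ : 0 < γ) (hγβ : γ < β) {q : ℝ≥0∞}
    (hq : 0 < q) : IsZeroSequence (fockSpace β q) (squareLattice γ) := by
  have hpi := Real.pi_pos
  set s : ℝ := Real.sqrt (Real.pi / γ) with hs
  have hs0 : 0 < s := Real.sqrt_pos.mpr (by positivity)
  have hs2 : s ^ 2 = Real.pi / γ := Real.sq_sqrt (by positivity)
  have hsc : (s : ℂ) ≠ 0 := by exact_mod_cast hs0.ne'
  obtain ⟨M, hM, hle⟩ := exists_norm_latticeFunction_le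
  refine ⟨fun z ↦ latticeFunction ((s : ℂ)⁻¹ * z), ?_, ?_, fun w ↦ ?_⟩
  · refine mem_fockSpace_of_norm_le hγβ hq
      (differentiable_latticeFunction.comp (differentiable_id.const_mul _)) hM fun z ↦
      (hle _).trans_eq ?_
    rw [norm_mul, norm_inv, Complex.norm_real, Real.norm_of_nonneg hs0.le, mul_pow, inv_pow, hs2]
    congr 2
    field_simp
  · intro h
    -- The point `1/2` is not a Gaussian integer, so the function is nonzero here.
    have h1 := congrFun h (s * (1 / 2))
    simp only [Pi.zero_apply, inv_mul_cancel_left₀ hsc, latticeFunction_eq_zero_iff] at h1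
    obtain ⟨m, n, h1⟩ := h1
    have h2 := congrArg Complex.re h1
    simp at h2
    have h3 : (1 : ℝ) = ((2 * m : ℤ) : ℝ) := by push_cast; linarith
    have h4 : (1 : ℤ) = 2 * m := by exact_mod_cast h3
    omega
  · rw [analyticOrderAt_comp_const_mul _ (inv_ne_zero hsc), ← encard_squareLattice_fiber hγ, ← hs,
      mul_inv_cancel_left₀ hsc]

/-- Off discs around the lattice points a bound for the quotient by the lattice function is
immediate; inside them the maximum principle on a circle that avoids the discs gives it. -/
theorem eq_zero_of_analyticOrderAt_latticeFunction_le {f : ℂ → ℂ} (hf : Differentiable ℂ f)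
    (hord : ∀ z, analyticOrderAt latticeFunction z ≤ analyticOrderAt f z) {C a : ℝ}
    (ha : a < Real.pi / 2) (hle : ∀ z, ‖f z‖ ≤ C * Real.exp (a * ‖z‖ ^ 2)) : f = 0 := by
  obtain ⟨h, hd, hfh⟩ := exists_differentiable_mul_of_analyticOrderAt_le hf
    differentiable_latticeFunction
    (fun z ↦ by rw [analyticOrderAt_latticeFunction]; split_ifs <;> simp) hord
  obtain ⟨c, hc, hlow⟩ := exists_le_norm_latticeFunction
  set δ := Real.pi / 2 - a with hδ
  have hδ0 : 0 < δ := sub_pos.mpr ha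
  have hC : 0 ≤ C := by
    have := (norm_nonneg _).trans (hle 0)
    simpa using this
  have hoff : ∀ z : ℂ, (∀ m n : ℤ, 1 / 4 ≤ ‖z - (m + n * Complex.I)‖) →
      ‖h z‖ ≤ C / c * Real.exp (-δ * ‖z‖ ^ 2) := fun z hz ↦ by
    have h1 := hle z
    rw [hfh, norm_mul] at h1
    have h2 := (mul_le_mul_of_nonneg_right (hlow z hz) (norm_nonneg (h z))).trans h1
    have h3 : Real.exp (a * ‖z‖ ^ 2) =
        Real.exp (Real.pi / 2 * ‖z‖ ^ 2) * Real.exp (-δ * ‖z‖ ^ 2) := by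
      rw [← Real.exp_add, hδ]
      ring_nf
    rw [h3] at h2
    rw [div_mul_eq_mul_div, le_div_iff₀ hc]
    refine le_of_mul_le_mul_left ?_ (Real.exp_pos (Real.pi / 2 * ‖z‖ ^ 2))
    linarith
  -- The loss of `1/2` is the radius of the circle used below; `1 ≤ ‖z‖` keeps the difference
  -- nonnegative, so squaring is monotone.
  have hball : ∀ z : ℂ, 1 ≤ ‖z‖ → ‖h z‖ ≤ C / c * Real.exp (-δ * (‖z‖ - 1 / 2) ^ 2) := by
    intro z hz
    have hmono : ∀ x : ℝ, ‖z‖ - 1 / 2 ≤ x →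
        C / c * Real.exp (-δ * x ^ 2) ≤ C / c * Real.exp (-δ * (‖z‖ - 1 / 2) ^ 2) := fun x hx ↦ by
      have : (‖z‖ - 1 / 2) ^ 2 ≤ x ^ 2 := pow_le_pow_left₀ (by linarith) hx 2
      refine mul_le_mul_of_nonneg_left (Real.exp_le_exp.mpr ?_) (by positivity)
      nlinarith
    by_cases hfar : ∀ m n : ℤ, 1 / 4 ≤ ‖z - (m + n * Complex.I)‖
    · exact (hoff z hfar).trans (hmono _ (by linarith))
    push Not at hfar
    obtain ⟨m, n, hmn⟩ := hfar
    -- Here `z` is within `1/4` of a lattice point. On the circle of radius `1/2` about `z`, that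
    -- point is at distance at least `1/2 - 1/4`, and any other at least `1 - 1/4 - 1/2`.
    refine Complex.norm_le_of_forall_mem_frontier_norm_le (U := Metric.ball z (1 / 2))
      Metric.isBounded_ball hd.diffContOnCl (fun w hw ↦ ?_)
      (subset_closure (Metric.mem_ball_self (by norm_num)))
    rw [frontier_ball _ (by norm_num), mem_sphere_iff_norm] at hw
    refine (hoff w fun m' n' ↦ ?_).trans (hmono _ ?_)
    · by_cases heq : m' = m ∧ n' = n
      · rw [heq.1, heq.2]
        have := norm_sub_le_norm_sub_add_norm_sub w (m + n * Complex.I) z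
        rw [norm_sub_rev ((m : ℂ) + n * Complex.I) z] at this
        linarith
      · have hone : 1 ≤ ‖((m' : ℂ) + n' * Complex.I) - (m + n * Complex.I)‖ := by
          have h1 : (1 : ℝ) ≤ ((m' - m) ^ 2 + (n' - n) ^ 2 : ℤ) := by
            have : 0 < (m' - m) ^ 2 + (n' - n) ^ 2 := by
              rcases not_and_or.mp heq with h | h
              · have := pow_pos (abs_pos.mpr (sub_ne_zero.mpr h)) 2
                rw [sq_abs] at this
                positivity
              · have := pow_pos (abs_pos.mpr (sub_ne_zero.mpr h)) 2
                rw [sq_abs] at this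
                positivity
            exact_mod_cast this
          rw [← one_le_sq_iff₀ (norm_nonneg _), sq_norm_eq]
          simpa using h1
        have h1 := norm_sub_le_norm_sub_add_norm_sub ((m' : ℂ) + n' * Complex.I) w
          (m + n * Complex.I)
        have h2 := norm_sub_le_norm_sub_add_norm_sub w z (m + n * Complex.I)
        rw [norm_sub_rev _ w] at h1
        linarith
    · have := norm_sub_norm_le z w
      rw [norm_sub_rev] at this
      linarith
  have hlim : Tendsto h (cocompact ℂ) (𝓝 0) := by
    refine squeeze_zero_norm' (a := fun z ↦ C / c * Real.exp (-δ * (‖z‖ - 1 / 2) ^ 2)) ?_ ?_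
    · filter_upwards [(tendsto_norm_cocompact_atTop (E := ℂ)).eventually_ge_atTop 1] with z hz
      exact hball z hz
    · have h1 : Tendsto (fun x : ℝ ↦ δ * (x - 1 / 2) ^ 2) atTop atTop :=
        Tendsto.const_mul_atTop hδ0 ((tendsto_pow_atTop two_ne_zero).comp
          (tendsto_atTop_add_const_right _ _ tendsto_id))
      have h2 := (Real.tendsto_exp_neg_atTop_nhds_zero.comp
        (h1.comp (tendsto_norm_cocompact_atTop (E := ℂ)))).const_mul (C / c)
      simpa [Function.comp_def, neg_mul] using h2
  funext z
  -- Liouville: an entire function with limit `0` at infinity is zero.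
  rw [hfh, hd.apply_eq_of_tendsto_cocompact z hlim, mul_zero, Pi.zero_apply]

theorem not_isZeroSequence_fockSpace_squareLattice {α γ : ℝ} (hα : 0 < α) (hαγ : α < γ) {p : ℝ≥0∞}
    (hp : 0 < p) : ¬ IsZeroSequence (fockSpace α p) (squareLattice γ) := by
  rintro ⟨f, hf, hf0, hord⟩
  have hpi := Real.pi_pos
  have hγ : 0 < γ := hα.trans hαγ
  set s : ℝ := Real.sqrt (Real.pi / γ) with hs
  have hs0 : 0 < s := Real.sqrt_pos.mpr (by positivity)
  have hs2 : s ^ 2 = Real.pi / γ := Real.sq_sqrt (by positivity)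
  have hsc : (s : ℂ) ≠ 0 := by exact_mod_cast hs0.ne'
  obtain ⟨α', h1, h2⟩ := exists_between hαγ
  obtain ⟨C, hC, hle⟩ := exists_norm_le_of_mem_fockSpace hα h1 hp hf
  -- Rescaling moves the zeros to `ℤ + iℤ` and the growth rate to `(α'/2)(π/γ)`, which is below
  -- `π/2` since `α' < γ`.
  have hz : (fun z ↦ f (s * z)) = 0 := by
    refine eq_zero_of_analyticOrderAt_latticeFunction_le (C := C) (a := α' / 2 * (Real.pi / γ))
      (hf.1.comp (differentiable_id.const_mul _)) (fun z ↦ ?_) ?_ fun z ↦ (hle _).trans_eq ?_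
    · rw [analyticOrderAt_comp_const_mul _ hsc, hord, ← encard_squareLattice_fiber hγ]
    · rw [← mul_div_assoc, div_lt_iff₀ hγ]
      nlinarith
    · rw [norm_mul, Complex.norm_real, Real.norm_of_nonneg hs0.le, mul_pow, hs2, mul_assoc]
  refine hf0 (funext fun z ↦ ?_)
  have := congrFun hz ((s : ℂ)⁻¹ * z)
  simpa [mul_inv_cancel_left₀ hsc] using this

theorem IsZeroSequence.mono {ι : Type*} {X Y : Set (ℂ → ℂ)} (hXY : X ⊆ Y) {Z : ι → ℂ}
    (h : IsZeroSequence X Z) : IsZeroSequence Y Z := by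
  obtain ⟨f, hf, hf'⟩ := h
  exact ⟨f, hXY hf, hf'⟩

theorem isZeroSequence_comp_equiv {ι κ : Type*} (e : κ ≃ ι) {X : Set (ℂ → ℂ)} {Z : ι → ℂ} :
    IsZeroSequence X (Z ∘ e) ↔ IsZeroSequence X Z := by
  have : ∀ w, {i | (Z ∘ e) i = w}.encard = {i | Z i = w}.encard := fun w ↦
    encard_preimage_of_bijective e.bijective {i | Z i = w}
  simp only [IsZeroSequence, this]

end ZeroSequences

theorem corollary3 (α β : ℝ) (hα : 0 < α) (hαβ : α < β)
    (p q : ℝ≥0∞) (hp : 0 < p) (hq : 0 < q) :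
    (∀ (ι : Type*) (Z : ι → ℂ),
      IsZeroSequence (fockSpace α p) Z → IsZeroSequence (fockSpace β q) Z) ∧
    (∃ Z : ℕ → ℂ,
      IsZeroSequence (fockSpace β q) Z ∧ ¬ IsZeroSequence (fockSpace α p) Z) ∧
    (∀ γ : ℝ, α < γ → γ < β →
      IsZeroSequence (fockSpace β q) (squareLattice γ) ∧
        ¬ IsZeroSequence (fockSpace α p) (squareLattice γ)) := by
  have hlattice : ∀ γ : ℝ, α < γ → γ < β → IsZeroSequence (fockSpace β q) (squareLattice γ) ∧
      ¬ IsZeroSequence (fockSpace α p) (squareLattice γ) := fun γ h1 h2 ↦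
    ⟨isZeroSequence_fockSpace_squareLattice (hα.trans h1) h2 hq,
      not_isZeroSequence_fockSpace_squareLattice hα h1 hp⟩
  refine ⟨fun ι Z ↦ IsZeroSequence.mono (fockSpace_subset_fockSpace hα hαβ hp hq), ?_, hlattice⟩
  obtain ⟨γ, h1, h2⟩ := exists_between hαβ
  obtain ⟨e⟩ : Nonempty (ℕ ≃ ℤ × ℤ) := nonempty_equiv_of_countable
  refine ⟨squareLattice γ ∘ e, ?_⟩
  simpa only [isZeroSequence_comp_equiv] using hlattice γ h1 h2
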